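/- \textbf{Setting.} Let $K$ be a field with decidable equality. Let $\alpha$ be a set of (abstract) power-products with decidable equality: a cancellative commutative monoid with exact division of multiples, least common multiples, in which $st=1$ implies $s=1$, and which admits a Dickson grading, i.e. a map $d:\alpha\to\mathbb N$ with $d(st)=\max(d(s),d(t))$ such that every infinite sequence of elements of grade at most $n$ contains $s_i\mid s_j$ with $i<j$, for each $n$. (For instance, the power-products in finitely or countably many indeterminates.) Let $\kappa$ be a non-empty well-ordered set of component indices. A term is a pair $s\,e_i$ with $s\in\alpha$, $i\in\kappa$, and $t\cdot(s\,e_i)=(ts)\,e_i$; $s\,e_i$ divides $t\,e_j$ iff $i=j$ and $s\mid t$. A polynomial is a finitely supported map from terms to $K$. Let $\preceq$ be a linear order on $\alpha$ with $1\preceq t$ and $s\preceq t\Rightarrow su\preceq tu$, and let $\preceq_{\mathsf t}$ be a linear order on terms with $v\preceq_{\mathsf t}w\Rightarrow t\cdot v\preceq_{\mathsf t}t\cdot w$, and with $s\,e_i\preceq_{\mathsf t}t\,e_j$ whenever $s\preceq t$ and $i\le j$. For $p\ne0$ let $\mathrm{lt}(p)=\mathrm{lp}(p)\,e_i$ be the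 $\preceq_{\mathsf t}$-largest term of $p$, $\mathrm{lc}(p)$ its coefficient, and $\mathrm{tail}(p)=p-\mathrm{lc}(p)\,\mathrm{lt}(p)$; by convention $\mathrm{lt}(0)$ is the smallest term, $\mathrm{lc}(0)=0$ and $1/0=0$ in $K$. For a set $F$ of polynomials, $\mathrm{pmdl}(F)$ is the smallest set that contains $F\cup\{0\}$ and is closed under addition and under multiplication by elements of $K$ and of $\alpha$. Write $p\to_F q$ if $q=p-\frac{c}{\mathrm{lc}(f)}\,t\,f$ for some non-zero $f\in F$ and some $t\in\alpha$ such that the coefficient $c$ of $t\cdot\mathrm{lt}(f)$ in $p$ is non-zero. A normal form of $p$ modulo $F$ is a $\to_F$-irreducible $r$ with $p\to_F^*r$; $F$ is a Gröbner basis if $\to_F$ is confluent. A list is identified with the set of its elements where a set is expected. \textbf{Algorithms.} $\mathrm{trd}(fs,p)$ (total reduction): start with $r=0$; while $p\neq0$, take the first non-zero $f$ in the list $fs$ such that $\mathrm{lt}(f)$ divides $\mathrm{lt}(p)$ and replace $p$ by $\mathrm{tail}(p)-\frac{\mathrm{lc}(p)}{\mathrm{lc}(f)}\frac{\mathrm{lp}(p)}{\mathrm{lp}(f)}\,\mathrm{tail}(f)$;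 if there is no such $f$, add $\mathrm{lc}(p)\,\mathrm{lt}(p)$ to $r$ and replace $p$ by $\mathrm{tail}(p)$. When $p=0$, return $r$. $\mathrm{spoly}(p,q)$ is $\frac{l}{\mathrm{lc}(p)\,\mathrm{lp}(p)}p-\frac{l}{\mathrm{lc}(q)\,\mathrm{lp}(q)}q$ with $l=\mathrm{lcm}(\mathrm{lp}(p),\mathrm{lp}(q))$ if $\mathrm{lt}(p)$ and $\mathrm{lt}(q)$ have the same component index, and $0$ otherwise. $\mathrm{gb}(fs)$ (Buchberger's algorithm): start with the list $bs=fs$ and with a list $ps$ containing one pair for every two distinct elements of $fs$. While $ps$ is non-empty and it is not the case that for every component index $i$ occurring in $bs$ there is a non-zero $b\in bs$ with $\mathrm{lt}(b)=1\,e_i$: select a pair $(p,q)$ from $ps$, remove it from $ps$, and compute $h=\mathrm{trd}(bs,\mathrm{spoly}(p,q))$; if $h\neq0$, add all pairs $(h,b)$, $b\in bs$, to $ps$ and append $h$ to $bs$. Finally return $bs$. The function that selects one element of $ps$, depending on $bs$ and $ps$, is arbitrary. \textbf{Theorem (submodule membership via gb).} Let $fs$ be a finite list of polynomials. For every selection function,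 $\mathrm{gb}(fs)$ terminates, and its result is a Gröbner basis with $\mathrm{pmdl}(\mathrm{gb}(fs))=\mathrm{pmdl}(fs)$. For every polynomial $p$, $\mathrm{trd}(\mathrm{gb}(fs),p)$ terminates, its result is a normal form of $p$ modulo $\mathrm{gb}(fs)$, and \[ p\in\mathrm{pmdl}(fs)\iff \mathrm{trd}(\mathrm{gb}(fs),p)=0. \] Consequently the procedure that computes $\mathrm{gb}(fs)$, then $\mathrm{trd}(\mathrm{gb}(fs),p)$, and tests the result for $0$ is a decision procedure for submodule membership (relative to the basic operations of $K$, $\alpha$, $\kappa$, the orders and the selection function): it terminates on every input $(fs,p)$ and answers "true" if and only if $p\in\mathrm{pmdl}(fs)$. -/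

import Mathlib

/-- A Dickson grading: `d (s * t) = max (d s) (d t)`, and for every `n` divisibility is almost full
on `{t | d t ≤ n}`, i.e. every sequence of elements of grade at most `n` has an entry dividing a
later one. -/
def IsDicksonGrading {α : Type*} [Monoid α] (d : α → ℕ) : Prop :=
  (∀ s t : α, d (s * t) = max (d s) (d t)) ∧
    ∀ (n : ℕ) (s : ℕ → α), (∀ i, d (s i) ≤ n) → ∃ i j, i < j ∧ s i ∣ s j

/-- Abstract power-products: a cancellative commutative monoid with least common multiples, without
non-trivial units, and admitting a Dickson grading. As for every cancellative commutative monoid,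
there is a division operation that is exact on multiples (its other values are irrelevant). -/
class GradedDicksonPowerprod (α : Type*) extends CancelCommMonoid α, Div α where
  mul_div_cancel_left_pp : ∀ s t : α, (s * t) / s = t
  /-- The least common multiple. -/
  lcm : α → α → α
  dvd_lcm : ∀ s t : α, s ∣ lcm s t
  lcm_dvd : ∀ s t u : α, s ∣ u → t ∣ u → lcm s t ∣ u
  lcm_comm : ∀ s t : α, lcm s t = lcm t s
  times_eq_one : ∀ s t : α, s * t = 1 → s = 1
  ex_dgrad : ∃ d : α → ℕ, IsDicksonGrading d

namespace GroebnerBases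

variable {α κ β : Type*}

/-- Terms are pairs of a power-product and a component index; `stimes t v` multiplies the
power-product of `v` by `t`. -/
def stimes [Mul α] (t : α) (v : α × κ) : α × κ := (t * v.1, v.2)

/-- Divisibility of terms: `s e_i` divides `t e_j` iff `i = j` and `s` divides `t`. -/
def TermDvd [GradedDicksonPowerprod α] (v w : α × κ) : Prop := v.2 = w.2 ∧ v.1 ∣ w.1

theorem dvd_iff_mul_div [GradedDicksonPowerprod α] (s t : α) : s ∣ t ↔ s * (t / s) = t := by
  constructor
  · rintro ⟨u, rfl⟩
    rw [GradedDicksonPowerprod.mul_div_cancel_left_pp]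
  · intro h
    exact ⟨t / s, h.symm⟩

instance [GradedDicksonPowerprod α] [DecidableEq α] [DecidableEq κ] (v w : α × κ) :
    Decidable (TermDvd v w) :=
  decidable_of_iff (v.2 = w.2 ∧ v.1 * (w.1 / v.1) = w.1)
    (and_congr_right fun _ => (dvd_iff_mul_div v.1 w.1).symm)

/-- Vector-polynomials: finitely supported maps from terms to coefficients. (`DFinsupp` rather than
`Finsupp`, so that the algorithms below are executable.) -/
abbrev VecPoly (α κ β : Type*) [Zero β] : Type _ := DFinsupp fun _ : α × κ => β

/-- An admissible order on power-products together with an admissible extension to terms. -/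
structure TermOrder (α κ : Type*) [GradedDicksonPowerprod α] [LinearOrder κ] where
  /-- The order on power-products. -/
  ord : LinearOrder α
  one_min : ∀ t : α, ord.le 1 t
  times_mono : ∀ s t u : α, ord.le s t → ord.le (s * u) (t * u)
  /-- The order on terms. -/
  ordTerm : LinearOrder (α × κ)
  stimes_mono : ∀ (v w : α × κ) (t : α), ordTerm.le v w → ordTerm.le (stimes t v) (stimes t w)
  ord_termI : ∀ v w : α × κ, ord.le v.1 w.1 → v.2 ≤ w.2 → ordTerm.le v w

variable [GradedDicksonPowerprod α] [DecidableEq α] [LinearOrder κ] [OrderBot κ]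
  [Field β] [DecidableEq β]

/-- Multiplication by a coefficient `c` and a power-product `t`. -/
def monomMult (c : β) (t : α) (p : VecPoly α κ β) : VecPoly α κ β :=
  ∑ v ∈ p.support, DFinsupp.single (stimes t v) (c * p v)

/-- The submodule generated by `B`: the smallest set containing `B ∪ {0}` that is closed under
addition and under multiplication by coefficients and power-products. -/
inductive InPmdl (B : Set (VecPoly α κ β)) : VecPoly α κ β → Prop
  | base (b : VecPoly α κ β) (hb : b ∈ B) : InPmdl B b
  | zero : InPmdl B 0
  | add (p q : VecPoly α κ β) (hp : InPmdl B p) (hq : InPmdl B q) : InPmdl B (p + q)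
  | monom (c : β) (t : α) (p : VecPoly α κ β) (hp : InPmdl B p) : InPmdl B (monomMult c t p)

/-- The submodule generated by `B`, as a set. -/
def pmdl (B : Set (VecPoly α κ β)) : Set (VecPoly α κ β) := {p | InPmdl B p}

namespace TermOrder

variable (o : TermOrder α κ)

/-- The leading term; by convention the smallest term if `p = 0`. -/
def lt (p : VecPoly α κ β) : α × κ :=
  if h : p.support.Nonempty then @Finset.max' _ o.ordTerm p.support h else (1, ⊥)

/-- The leading power-product. -/
def lp (p : VecPoly α κ β) : α := (o.lt p).1

/-- The leading coefficient (`0` if `p = 0`). -/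
def lc (p : VecPoly α κ β) : β := p (o.lt p)

/-- The tail: `p` without its leading monomial. -/
def tail (p : VecPoly α κ β) : VecPoly α κ β := p.erase (o.lt p)

/-! ### Reduction and Gröbner bases -/

/-- `p` reduces to `q` modulo `f` using `t`. -/
def RedSingle (p q f : VecPoly α κ β) (t : α) : Prop :=
  f ≠ 0 ∧ p (stimes t (o.lt f)) ≠ 0 ∧
    q = p - monomMult (p (stimes t (o.lt f)) / o.lc f) t f

/-- `p` reduces to `q` modulo the set `F` in one step. -/
def Red (F : Set (VecPoly α κ β)) (p q : VecPoly α κ β) : Prop :=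
  ∃ f ∈ F, ∃ t, o.RedSingle p q f t

/-- `q` is a normal form of `p` modulo `F`. -/
def IsNormalForm (F : Set (VecPoly α κ β)) (p q : VecPoly α κ β) : Prop :=
  Relation.ReflTransGen (o.Red F) p q ∧ ¬ ∃ q', o.Red F q q'

/-- `G` is a Gröbner basis: reduction modulo `G` is confluent. -/
def IsGB (G : Set (VecPoly α κ β)) : Prop :=
  ∀ a b c : VecPoly α κ β,
    Relation.ReflTransGen (o.Red G) a b → Relation.ReflTransGen (o.Red G) a c →
      ∃ d, Relation.ReflTransGen (o.Red G) b d ∧ Relation.ReflTransGen (o.Red G) c d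

/-! ### The algorithms

They are executable. General recursion takes values in `Option`: the value is `some x` if the
computation terminates with result `x`, and `none` if it runs forever. -/

/-- The first non-zero `f` in the list whose leading term divides `v`. -/
def findDvd : List (VecPoly α κ β) → α × κ → Option (VecPoly α κ β)
  | [], _ => none
  | f :: fs, v => if f ≠ 0 ∧ TermDvd (o.lt f) v then some f else findDvd fs v

/-- Total reduction with accumulator `r`: the terms are processed from the greatest one downwards,
irreducible ones being moved to `r`. -/
def trdAux (fs : List (VecPoly α κ β)) (p r : VecPoly α κ β) : Option (VecPoly α κ β) :=
  if p = 0 then some r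
  else
    match o.findDvd fs (o.lt p) with
    | none => trdAux fs (o.tail p) (r + DFinsupp.single (o.lt p) (o.lc p))
    | some f =>
      trdAux fs (o.tail p - monomMult (o.lc p / o.lc f) (o.lp p / o.lp f) (o.tail f)) r
  partial_fixpoint

/-- Total reduction of `p` modulo the list `fs`. -/
def trd (fs : List (VecPoly α κ β)) (p : VecPoly α κ β) : Option (VecPoly α κ β) :=
  o.trdAux fs p 0

/-- The S-polynomial. -/
def spoly (p q : VecPoly α κ β) : VecPoly α κ β :=
  if (o.lt p).2 = (o.lt q).2 then
    let l := GradedDicksonPowerprod.lcm (o.lp p) (o.lp q)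
    monomMult (1 / o.lc p) (l / o.lp p) p - monomMult (1 / o.lc q) (l / o.lp q) q
  else 0

/-- Does every component index `i` occurring in `bs` have a non-zero `b` in `bs` with leading term
`1 e_i`? -/
def genWholeModule (bs : List (VecPoly α κ β)) : Bool :=
  bs.all fun a => decide (∀ v ∈ a.support, ∃ b ∈ bs, b ≠ 0 ∧ o.lt b = (1, v.2))

end TermOrder

/-- All pairs of elements at different positions of a list, in the order of the list. -/
def listPairs {γ : Type*} : List γ → List (γ × γ)
  | [] => []
  | h :: hs => hs.map (fun g => (h, g)) ++ listPairs hs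

/-- The pairs in `ps`, the pairs `(h, b)` for `h` in `hs` and `b` in `bs`, and one of the pairs
`(h₁, h₂)`, `(h₂, h₁)` for all distinct `h₁`, `h₂` in `hs`. -/
def addPairs {γ : Type*} [DecidableEq γ] (bs : List γ) (ps : List (γ × γ)) (hs : List γ) :
    List (γ × γ) :=
  ps ++ hs.product bs ++ listPairs hs.dedup

/-- `diffList xs ys` removes all occurrences of all elements of `ys` from `xs`. -/
def diffList {γ : Type*} [DecidableEq γ] (xs ys : List γ) : List γ :=
  xs.filter fun x => decide (x ∉ ys)

/-- `sel` selects a single pair: if `ps` is non-empty, `sel bs ps` is a one-element list whose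
element belongs to `ps`. -/
def SelectsSinglePair {γ : Type*} (sel : List γ → List (γ × γ) → List (γ × γ)) : Prop :=
  ∀ bs ps, ps ≠ [] → ∃ x ∈ ps, sel bs ps = [x]

namespace TermOrder

variable (o : TermOrder α κ)

/-- The algorithm schema: `bs` is the current basis, `ps` the list of pairs still to be
considered. -/
def gbSchemaAux
    (sel : List (VecPoly α κ β) → List (VecPoly α κ β × VecPoly α κ β) →
      List (VecPoly α κ β × VecPoly α κ β))
    (compl : List (VecPoly α κ β) → List (VecPoly α κ β × VecPoly α κ β) →
      List (VecPoly α κ β × VecPoly α κ β) → Option (List (VecPoly α κ β)))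
    (bs : List (VecPoly α κ β)) (ps : List (VecPoly α κ β × VecPoly α κ β)) :
    Option (List (VecPoly α κ β)) :=
  if ps = [] ∨ o.genWholeModule bs = true then some bs
  else do
    let hs ← compl bs (diffList ps (sel bs ps)) (sel bs ps)
    gbSchemaAux sel compl (bs ++ hs) (addPairs bs (diffList ps (sel bs ps)) hs)
  partial_fixpoint

/-- The algorithm schema with the right initial values. -/
def gbSchema
    (sel : List (VecPoly α κ β) → List (VecPoly α κ β × VecPoly α κ β) →
      List (VecPoly α κ β × VecPoly α κ β))
    (compl : List (VecPoly α κ β) → List (VecPoly α κ β × VecPoly α κ β) →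
      List (VecPoly α κ β × VecPoly α κ β) → Option (List (VecPoly α κ β)))
    (fs : List (VecPoly α κ β)) : Option (List (VecPoly α κ β)) :=
  o.gbSchemaAux sel compl fs (addPairs [] [] fs)

/-- The completion step of Buchberger's algorithm: the S-polynomial of the selected pair is totally
reduced modulo `bs`, and the result is returned if it is non-zero. -/
def gbRed (bs : List (VecPoly α κ β)) (_ps : List (VecPoly α κ β × VecPoly α κ β)) :
    List (VecPoly α κ β × VecPoly α κ β) → Option (List (VecPoly α κ β))
  | [] => some []
  | (p, q) :: _ => (o.trd bs (o.spoly p q)).map fun h => if h = 0 then [] else [h]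

/-- Buchberger's algorithm with selection strategy `sel`. -/
def gb
    (sel : List (VecPoly α κ β) → List (VecPoly α κ β × VecPoly α κ β) →
      List (VecPoly α κ β × VecPoly α κ β))
    (fs : List (VecPoly α κ β)) : Option (List (VecPoly α κ β)) :=
  o.gbSchema sel o.gbRed fs

/-- The membership test: compute a Gröbner basis, totally reduce `p` modulo it, and check whether
the result is `0`. -/
def memTest
    (sel : List (VecPoly α κ β) → List (VecPoly α κ β × VecPoly α κ β) →
      List (VecPoly α κ β × VecPoly α κ β))
    (fs : List (VecPoly α κ β)) (p : VecPoly α κ β) : Option Bool :=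
  (o.gb sel fs).bind fun G => (o.trd G p).map fun r => decide (r = 0)

end TermOrder

end GroebnerBases

set_option linter.unusedSectionVars false

namespace GroebnerBases

/-! ### Monomial multiplication and the generated submodule -/

section Multiplication

variable {α κ β : Type*} [GradedDicksonPowerprod α]

/-! Confluence is replaced by a leading term condition (`LeadCond`): every non-zero element of the
submodule has a leading term divisible by one from the basis. An irreducible element of the
submodule is then `0`, which yields both confluence (`LeadCond.isGB`) and the membership test
(`LeadCond.mem_pmdl_iff`).

With infinitely many indeterminates the term order need not be well-founded, so every argument is
confined to terms of grade at most some `n`. There Dickson's property gives well-foundedness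
(`wellFoundedOn_grade_le`), hence termination of total reduction (`trdAux_spec`). S-polynomials and
total reduction never raise the grade, since the lcm divides the product, so one `n` serves a whole
run.

If all S-polynomials have representations below the lcm of the leading terms, any representation
whose highest multiples cancel can be lowered; induction on its bound gives `LeadCond`
(`not_irredTerm_of_mem_repSpan`). Buchberger's algorithm maintains such representations for
processed pairs (`GBInv.step`). It stops because the new leading terms have bounded grade, finitely
many components, and no earlier one divides a later one (`wellFounded_extends`). -/

theorem stimes_injective (t : α) : Function.Injective (stimes t : α × κ → α × κ) := by
  rintro ⟨a, i⟩ ⟨b, j⟩ h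
  simp only [stimes, Prod.mk.injEq, mul_right_inj] at h
  exact Prod.ext h.1 h.2

theorem stimes_stimes (s t : α) (v : α × κ) : stimes s (stimes t v) = stimes (s * t) v := by
  simp [stimes, mul_assoc]

theorem one_stimes (v : α × κ) : stimes 1 v = v := by simp [stimes]

theorem termDvd_iff_exists_stimes {v w : α × κ} : TermDvd v w ↔ ∃ t, w = stimes t v := by
  constructor
  · rintro ⟨h, t, ht⟩
    exact ⟨t, Prod.ext (by simp [stimes, ht, mul_comm]) h.symm⟩
  · rintro ⟨t, rfl⟩
    exact ⟨rfl, t, by simp [stimes, mul_comm]⟩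

theorem TermDvd.stimes_div {v w : α × κ} (h : TermDvd v w) : stimes (w.1 / v.1) v = w :=
  Prod.ext (by simpa [stimes, mul_comm] using (dvd_iff_mul_div v.1 w.1).1 h.2) h.1

variable [DecidableEq α] [LinearOrder κ] [Field β] [DecidableEq β]

theorem monomMult_apply_stimes (c : β) (t : α) (p : VecPoly α κ β) (v : α × κ) :
    monomMult c t p (stimes t v) = c * p v := by
  classical
  rw [monomMult, DFinsupp.finsetSum_apply]
  rw [Finset.sum_eq_single v]
  · simp
  · intro w _ hw
    rw [DFinsupp.single_apply, dif_neg fun h => hw (stimes_injective t h)]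
  · intro hv
    simp at hv
    simp [hv]

theorem monomMult_apply_eq_zero (c : β) (t : α) (p : VecPoly α κ β) (w : α × κ)
    (h : ∀ v, w ≠ stimes t v) : monomMult c t p w = 0 := by
  rw [monomMult, DFinsupp.finsetSum_apply]
  refine Finset.sum_eq_zero fun v _ => ?_
  rw [DFinsupp.single_apply, dif_neg fun h' => h v h'.symm]

theorem exists_of_monomMult_apply_ne_zero {c : β} {t : α} {p : VecPoly α κ β} {w : α × κ}
    (h : monomMult c t p w ≠ 0) : ∃ v, w = stimes t v ∧ p v ≠ 0 := by
  by_cases hw : ∃ v, w = stimes t v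
  · obtain ⟨v, rfl⟩ := hw
    rw [monomMult_apply_stimes] at h
    exact ⟨v, rfl, right_ne_zero_of_mul h⟩
  · push Not at hw
    exact absurd (monomMult_apply_eq_zero c t p w hw) h

/-- A term is either a multiple of `t`, by a unique cofactor, or not; this replaces sum
manipulations in the algebraic identities below. -/
theorem monomMult_ext {c : β} {t : α} {p q : VecPoly α κ β}
    (h : ∀ v, q (stimes t v) = c * p v) (h' : ∀ w, (∀ v, w ≠ stimes t v) → q w = 0) :
    monomMult c t p = q := by
  ext w
  by_cases hw : ∃ v, w = stimes t v
  · obtain ⟨v, rfl⟩ := hw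
    rw [monomMult_apply_stimes, h]
  · push Not at hw
    rw [monomMult_apply_eq_zero _ _ _ _ hw, h' w hw]

theorem monomMult_add (c : β) (t : α) (p q : VecPoly α κ β) :
    monomMult c t (p + q) = monomMult c t p + monomMult c t q :=
  monomMult_ext (fun v => by simp [monomMult_apply_stimes, mul_add])
    fun w hw => by simp [monomMult_apply_eq_zero _ _ _ _ hw]

theorem monomMult_smul (a c : β) (t : α) (p : VecPoly α κ β) :
    monomMult c t (a • p) = a • monomMult c t p :=
  monomMult_ext (fun v => by simp [monomMult_apply_stimes, mul_left_comm])
    fun w hw => by simp [monomMult_apply_eq_zero _ _ _ _ hw]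

/-- Multiplication by a power-product as a linear map. -/
def monomMultLinear (t : α) : VecPoly α κ β →ₗ[β] VecPoly α κ β where
  toFun := monomMult 1 t
  map_add' := monomMult_add 1 t
  map_smul' a p := monomMult_smul a 1 t p

theorem monomMultLinear_apply (t : α) (p : VecPoly α κ β) :
    monomMultLinear t p = monomMult 1 t p := rfl

theorem monomMult_eq_smul (c : β) (t : α) (p : VecPoly α κ β) :
    monomMult c t p = c • monomMult 1 t p :=
  monomMult_ext (fun v => by simp [monomMult_apply_stimes])
    fun w hw => by simp [monomMult_apply_eq_zero _ _ _ _ hw]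

theorem monomMult_sub (c : β) (t : α) (p q : VecPoly α κ β) :
    monomMult c t (p - q) = monomMult c t p - monomMult c t q :=
  monomMult_ext (fun v => by simp [monomMult_apply_stimes, mul_sub])
    fun w hw => by simp [monomMult_apply_eq_zero _ _ _ _ hw]

theorem monomMult_monomMult (a c : β) (s t : α) (p : VecPoly α κ β) :
    monomMult a s (monomMult c t p) = monomMult (a * c) (s * t) p := by
  symm
  refine monomMult_ext (fun v => ?_) fun w hw => ?_
  · rw [← stimes_stimes, monomMult_apply_stimes, monomMult_apply_stimes, mul_assoc]
  · by_contra h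
    obtain ⟨v, rfl, hv⟩ := exists_of_monomMult_apply_ne_zero h
    obtain ⟨u, rfl, -⟩ := exists_of_monomMult_apply_ne_zero hv
    exact hw u (stimes_stimes s t u)

theorem monomMult_one_right (c : β) (p : VecPoly α κ β) : monomMult c 1 p = c • p :=
  monomMult_ext (fun v => by simp [one_stimes]) fun w hw => absurd (one_stimes w).symm (hw w)

theorem monomMult_single (c a : β) (t : α) (v : α × κ) :
    monomMult c t (DFinsupp.single v a : VecPoly α κ β) = DFinsupp.single (stimes t v) (c * a) := by
  refine monomMult_ext (fun w => ?_) fun w hw => ?_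
  · simp [DFinsupp.single_apply, (stimes_injective t).eq_iff]
  · rw [DFinsupp.single_apply, dif_neg fun h => hw v h.symm]

/-- The generated submodule as a `β`-submodule. -/
def pmdlSubmodule (B : Set (VecPoly α κ β)) : Submodule β (VecPoly α κ β) where
  carrier := pmdl B
  add_mem' hp hq := InPmdl.add _ _ hp hq
  zero_mem' := InPmdl.zero
  smul_mem' c p hp := by
    rw [← monomMult_one_right]
    exact InPmdl.monom c 1 p hp

theorem mem_pmdlSubmodule {B : Set (VecPoly α κ β)} {p : VecPoly α κ β} :
    p ∈ pmdlSubmodule B ↔ p ∈ pmdl B := Iff.rfl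

theorem monomMult_mem_pmdl {B : Set (VecPoly α κ β)} {p : VecPoly α κ β} (c : β) (t : α)
    (hp : p ∈ pmdl B) : monomMult c t p ∈ pmdl B :=
  InPmdl.monom c t p hp

theorem pmdl_subset_of_subset_pmdl {A B : Set (VecPoly α κ β)} (h : A ⊆ pmdl B) :
    pmdl A ⊆ pmdl B := by
  intro p hp
  induction hp with
  | base b hb => exact h hb
  | zero => exact InPmdl.zero
  | add p q _ _ hp hq => exact InPmdl.add p q hp hq
  | monom c t p _ hp => exact InPmdl.monom c t p hp

/-- Multiplication by power-products preserves components. This keeps a run within the finitely many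
components of the input and justifies the early exit of the algorithm. -/
theorem exists_component_of_mem_pmdl {B : Set (VecPoly α κ β)} {p : VecPoly α κ β}
    (hp : p ∈ pmdl B) {v : α × κ} (hv : p v ≠ 0) : ∃ b ∈ B, ∃ w, b w ≠ 0 ∧ w.2 = v.2 := by
  induction hp generalizing v with
  | base b hb => exact ⟨b, hb, v, hv, rfl⟩
  | zero => simp at hv
  | add p q _ _ hp hq =>
    by_cases h : p v = 0
    · exact hq (by simpa [h] using hv)
    · exact hp h
  | monom c t p _ hp =>
    obtain ⟨w, h, hw⟩ := exists_of_monomMult_apply_ne_zero hv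
    obtain ⟨b, hb, u, hu, huw⟩ := hp hw
    exact ⟨b, hb, u, hu, huw.trans (congrArg Prod.snd h).symm⟩

end Multiplication

namespace TermOrder

variable {α κ β : Type*} [GradedDicksonPowerprod α] [LinearOrder κ]

/-! ### Term orders and Dickson gradings -/

section Terms

variable (o : TermOrder α κ)

theorem stimes_strictMono (t : α) {v w : α × κ} (h : o.ordTerm.lt v w) :
    o.ordTerm.lt (stimes t v) (stimes t w) := by
  let _ := o.ordTerm
  have h' : v < w := h
  exact lt_of_le_of_ne (o.stimes_mono v w t h'.le) fun e => h'.ne (stimes_injective t e)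

theorem ordTerm_le_of_dvd {v w : α × κ} (h : v.1 ∣ w.1) (h' : v.2 ≤ w.2) :
    o.ordTerm.le v w := by
  refine o.ord_termI v w ?_ h'
  obtain ⟨t, ht⟩ := h
  have := o.times_mono 1 t v.1 (o.one_min t)
  rwa [one_mul, mul_comm, ← ht] at this

variable {d : α → ℕ}

theorem _root_.IsDicksonGrading.le_of_dvd (hd : IsDicksonGrading d) {s t : α} (h : s ∣ t) :
    d s ≤ d t := by
  obtain ⟨u, rfl⟩ := h
  rw [hd.1]
  exact le_max_left _ _

theorem _root_.IsDicksonGrading.lcm_le (hd : IsDicksonGrading d) (s t : α) :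
    d (GradedDicksonPowerprod.lcm s t) ≤ max (d s) (d t) := by
  rw [← hd.1]
  exact hd.le_of_dvd (GradedDicksonPowerprod.lcm_dvd _ _ _ (Dvd.intro _ rfl) (Dvd.intro_left _ rfl))

theorem _root_.IsDicksonGrading.partiallyWellOrderedOn (hd : IsDicksonGrading d) (n : ℕ) :
    {t : α | d t ≤ n}.PartiallyWellOrderedOn (· ∣ ·) :=
  Set.partiallyWellOrderedOn_iff_exists_lt.2 fun f hf => hd.2 n f hf

theorem isPreorder_dvd (M : Type*) [Monoid M] : IsPreorder M (· ∣ ·) where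
  refl := dvd_refl
  trans _ _ _ := dvd_trans

/-- Divisibility of terms requires equal components, and equality is a well-quasi-order only on a
finite set; hence `C`. -/
theorem exists_termDvd_of_grade_le (hd : IsDicksonGrading d) (n : ℕ) {C : Set κ} (hC : C.Finite)
    (f : ℕ → α × κ) (hf : ∀ k, d (f k).1 ≤ n ∧ (f k).2 ∈ C) :
    ∃ i j, i < j ∧ TermDvd (f i) (f j) := by
  have := isPreorder_dvd α
  have := (hd.partiallyWellOrderedOn n).prod (hC.partiallyWellOrderedOn (r := (· = ·)))
  obtain ⟨i, j, hij, h⟩ := this.exists_lt (f := f) fun k => hf k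
  exact ⟨i, j, hij, h.2, h.1⟩

/-- The order on terms extends the product of divisibility and `≤` on components, a well-quasi-order
in bounded grade because `κ` is well-ordered. -/
theorem wellFoundedOn_grade_le [WellFoundedLT κ] (hd : IsDicksonGrading d) (n : ℕ) :
    {v : α × κ | d v.1 ≤ n}.WellFoundedOn o.ordTerm.lt := by
  have hκ : (Set.univ : Set κ).PartiallyWellOrderedOn (· ≤ ·) :=
    Set.partiallyWellOrderedOn_univ_iff.2 wellQuasiOrdered_le
  have := isPreorder_dvd α
  have hP := (hd.partiallyWellOrderedOn n).prod hκ
  let _ := o.ordTerm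
  refine Set.wellFoundedOn_iff_no_descending_seq.2 fun f hf => ?_
  obtain ⟨i, j, hij, h⟩ := hP.exists_lt (f := f) fun k => ⟨hf k, trivial⟩
  exact not_lt_of_ge (o.ordTerm_le_of_dvd h.1 h.2) (f.map_rel_iff.2 hij)

end Terms

end TermOrder

namespace TermOrder

variable {α κ β : Type*} [GradedDicksonPowerprod α] [DecidableEq α] [LinearOrder κ] [OrderBot κ]
  [Field β] [DecidableEq β] (o : TermOrder α κ)

/-! ### Leading terms and tails -/

section LeadingTerm

variable {p : VecPoly α κ β}

theorem lc_ne_zero (hp : p ≠ 0) : o.lc p ≠ 0 := by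
  have h : p.support.Nonempty := by
    rwa [Finset.nonempty_iff_ne_empty, Ne, DFinsupp.support_eq_empty]
  have := @Finset.max'_mem _ o.ordTerm p.support h
  rw [DFinsupp.mem_support_iff] at this
  rwa [lc, lt, dif_pos h]

theorem le_lt {v : α × κ} (hv : p v ≠ 0) : o.ordTerm.le v (o.lt p) := by
  have hv' : v ∈ p.support := DFinsupp.mem_support_iff.2 hv
  rw [lt, dif_pos ⟨v, hv'⟩]
  exact @Finset.le_max' _ o.ordTerm p.support v hv'

theorem lt_eq_of_forall_le {v : α × κ} (hv : p v ≠ 0) (h : ∀ w, p w ≠ 0 → o.ordTerm.le w v) :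
    o.lt p = v := by
  have hp : p ≠ 0 := by
    rintro rfl
    simp at hv
  exact o.ordTerm.le_antisymm _ _ (h _ (o.lc_ne_zero hp)) (o.le_lt hv)

theorem tail_apply (v : α × κ) : o.tail p v = if v = o.lt p then 0 else p v := by
  rw [tail, DFinsupp.erase_apply]

theorem tail_eq_sub : o.tail p = p - DFinsupp.single (o.lt p) (o.lc p) := by
  ext v
  rw [tail_apply, DFinsupp.sub_apply, DFinsupp.single_apply]
  split_ifs with h h' h'
  · subst h; simp [lc]
  · exact absurd h.symm h'
  · exact absurd h'.symm h
  · simp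

theorem lt_of_tail_apply_ne_zero {v : α × κ} (hv : o.tail p v ≠ 0) :
    o.ordTerm.lt v (o.lt p) := by
  rw [tail_apply] at hv
  split_ifs at hv with h
  · exact absurd rfl hv
  · let _ := o.ordTerm
    exact lt_of_le_of_ne (o.le_lt hv) h

theorem le_of_monomMult_apply_ne_zero {c : β} {t : α} {w : α × κ}
    (h : monomMult c t p w ≠ 0) : o.ordTerm.le w (stimes t (o.lt p)) := by
  obtain ⟨v, rfl, hv⟩ := exists_of_monomMult_apply_ne_zero h
  exact o.stimes_mono _ _ _ (o.le_lt hv)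

theorem monomMult_apply_stimes_lt (c : β) (t : α) (p : VecPoly α κ β) :
    monomMult c t p (stimes t (o.lt p)) = c * o.lc p :=
  monomMult_apply_stimes _ _ _ _

end LeadingTerm

/-! ### Representations by multiples with restricted leading terms -/

/-- The span of the multiples `t g` of elements of `G` whose leading terms satisfy `P`. -/
def repSpan (G : Set (VecPoly α κ β)) (P : α × κ → Prop) : Submodule β (VecPoly α κ β) :=
  Submodule.span β
    {m | ∃ t, ∃ g ∈ G, g ≠ 0 ∧ P (stimes t (o.lt g)) ∧ m = monomMult 1 t g}

variable {o} {G H : Set (VecPoly α κ β)} {P Q : α × κ → Prop} {p : VecPoly α κ β}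

theorem monomMult_mem_repSpan (c : β) (t : α) {g : VecPoly α κ β} (hg : g ∈ G) (h0 : g ≠ 0)
    (hP : P (stimes t (o.lt g))) : monomMult c t g ∈ o.repSpan G P := by
  rw [monomMult_eq_smul]
  exact Submodule.smul_mem _ _ (Submodule.subset_span ⟨t, g, hg, h0, hP, rfl⟩)

theorem repSpan_mono (hG : G ⊆ H) (hP : ∀ v, P v → Q v) : o.repSpan G P ≤ o.repSpan H Q :=
  Submodule.span_mono fun _ ⟨t, g, hg, h0, h, e⟩ => ⟨t, g, hG hg, h0, hP _ h, e⟩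

theorem monomMult_mem_repSpan_of_mem (t : α) (hp : p ∈ o.repSpan G P)
    (h : ∀ v, P v → Q (stimes t v)) : monomMult 1 t p ∈ o.repSpan G Q := by
  have : o.repSpan G P ≤ (o.repSpan G Q).comap (monomMultLinear t) := by
    refine Submodule.span_le.2 ?_
    rintro _ ⟨s, g, hg, h0, hP, rfl⟩
    rw [SetLike.mem_coe, Submodule.mem_comap, monomMultLinear_apply, monomMult_monomMult]
    exact monomMult_mem_repSpan _ _ hg h0 (stimes_stimes t s (o.lt g) ▸ h _ hP)
  exact this hp

theorem mem_repSpan_of_mem_pmdl (hp : p ∈ pmdl G) : p ∈ o.repSpan G fun _ => True := by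
  induction hp with
  | base b hb =>
    by_cases h0 : b = 0
    · rw [h0]; exact zero_mem _
    · have := monomMult_mem_repSpan (o := o) (P := fun _ => True) 1 1 hb h0 trivial
      rwa [monomMult_one_right, one_smul] at this
  | zero => exact zero_mem _
  | add p q _ _ hp hq => exact add_mem hp hq
  | monom c t p _ hp =>
    rw [monomMult_eq_smul]
    exact Submodule.smul_mem _ _ (monomMult_mem_repSpan_of_mem t hp fun _ _ => trivial)

theorem exists_le_of_mem_repSpan (hp : p ∈ o.repSpan G P) {w : α × κ} (hw : p w ≠ 0) :
    ∃ v, P v ∧ o.ordTerm.le w v := by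
  induction hp using Submodule.span_induction with
  | mem p hp =>
    obtain ⟨t, g, -, -, h, rfl⟩ := hp
    exact ⟨_, h, o.le_of_monomMult_apply_ne_zero hw⟩
  | zero => simp at hw
  | add p q _ _ hp hq =>
    by_cases h : p w = 0
    · exact hq (by simpa [h] using hw)
    · exact hp h
  | smul c p _ hp => exact hp fun h => hw (by simp [h])

/-- A non-empty finite representation has a highest multiple, which turns a strict bound into a
non-strict bound by a smaller term. This drives the induction in Buchberger's criterion. -/
theorem eq_zero_or_exists_mem_repSpan_le (hp : p ∈ o.repSpan G P) :
    p = 0 ∨ ∃ u, P u ∧ p ∈ o.repSpan G fun v => P v ∧ o.ordTerm.le v u := by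
  induction hp using Submodule.span_induction with
  | mem p hp =>
    obtain ⟨t, g, hg, h0, h, rfl⟩ := hp
    exact .inr ⟨_, h, monomMult_mem_repSpan _ _ hg h0 ⟨h, o.ordTerm.le_refl _⟩⟩
  | zero => exact .inl rfl
  | add p q _ _ hp hq =>
    rcases hp with rfl | ⟨u, hu, hp⟩
    · simpa using hq
    rcases hq with rfl | ⟨u', hu', hq⟩
    · exact .inr ⟨u, hu, by simpa using hp⟩
    · let _ := o.ordTerm
      rcases le_total u u' with h | h
      · exact .inr ⟨u', hu',
          add_mem (repSpan_mono subset_rfl (fun v hv => ⟨hv.1, hv.2.trans h⟩) hp) hq⟩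
      · exact .inr ⟨u, hu,
          add_mem hp (repSpan_mono subset_rfl (fun v hv => ⟨hv.1, hv.2.trans h⟩) hq)⟩
  | smul c p _ hp =>
    rcases hp with rfl | ⟨u, hu, hp⟩
    · simp
    · exact .inr ⟨u, hu, Submodule.smul_mem _ _ hp⟩

theorem exists_forall_mem_repSpan_grade_le (d : α → ℕ) (hp : p ∈ o.repSpan G P) :
    ∃ n₀, ∀ n, n₀ ≤ n → p ∈ o.repSpan G fun v => d v.1 ≤ n := by
  induction hp using Submodule.span_induction with
  | mem p hp =>
    obtain ⟨t, g, hg, h0, h, rfl⟩ := hp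
    exact ⟨_, fun n hn => monomMult_mem_repSpan _ _ hg h0 hn⟩
  | zero => exact ⟨0, fun n _ => zero_mem _⟩
  | add p q _ _ hp hq =>
    obtain ⟨a, ha⟩ := hp
    obtain ⟨b, hb⟩ := hq
    exact ⟨max a b, fun n hn =>
      add_mem (ha n (le_of_max_le_left hn)) (hb n (le_of_max_le_right hn))⟩
  | smul c p _ hp =>
    obtain ⟨a, ha⟩ := hp
    exact ⟨a, fun n hn => Submodule.smul_mem _ _ (ha n hn)⟩

end TermOrder

namespace TermOrder

variable {α κ β : Type*} [GradedDicksonPowerprod α] [DecidableEq α] [LinearOrder κ] [OrderBot κ]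
  [Field β] [DecidableEq β] (o : TermOrder α κ)

/-- All terms of `p` have grade at most `n`. -/
def GradeLE (d : α → ℕ) (n : ℕ) (p : VecPoly α κ β) : Prop := ∀ v, p v ≠ 0 → d v.1 ≤ n

/-- No leading term of a non-zero element of `F` divides `v`. -/
def IrredTerm (F : Set (VecPoly α κ β)) (v : α × κ) : Prop :=
  ∀ f ∈ F, f ≠ 0 → ¬ TermDvd (o.lt f) v

/-! ### Polynomials of bounded grade -/

section GradeLE

variable {d : α → ℕ} {n : ℕ} {p q : VecPoly α κ β}

theorem GradeLE.sub (hp : GradeLE d n p) (hq : GradeLE d n q) : GradeLE d n (p - q) := by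
  intro v hv
  by_cases h : p v = 0
  · exact hq v (by simpa [h] using hv)
  · exact hp v h

theorem GradeLE.monomMult (hd : IsDicksonGrading d) {t : α} (ht : d t ≤ n) (hp : GradeLE d n p)
    (c : β) : GradeLE d n (monomMult c t p) := by
  intro w hw
  obtain ⟨v, rfl, hv⟩ := exists_of_monomMult_apply_ne_zero hw
  exact (hd.1 t v.1).trans_le (max_le ht (hp v hv))

theorem GradeLE.tail (hp : GradeLE d n p) : GradeLE d n (o.tail p) := by
  intro v hv
  rw [tail_apply] at hv
  split_ifs at hv
  · exact absurd rfl hv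
  · exact hp v hv

/-- The condition on `d 1` covers `p = 0`, whose leading power-product is `1` by convention. -/
theorem GradeLE.lp_le (hn : d 1 ≤ n) (hp : GradeLE d n p) : d (o.lp p) ≤ n := by
  by_cases h0 : p = 0
  · simpa [h0, lp, lt] using hn
  · exact hp _ (o.lc_ne_zero h0)

end GradeLE

/-! ### Termination and correctness of total reduction -/

section TotalReduction

variable {o} {fs : List (VecPoly α κ β)} {F : Set (VecPoly α κ β)}

theorem findDvd_eq_none {v : α × κ} (h : o.findDvd fs v = none) : o.IrredTerm {f | f ∈ fs} v := by
  induction fs with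
  | nil => intro f hf; simp at hf
  | cons f fs ih =>
    rw [findDvd] at h
    split_ifs at h with hf
    intro g hg h0 hdvd
    rcases List.mem_cons.1 hg with rfl | hg
    · exact hf ⟨h0, hdvd⟩
    · exact ih h g hg h0 hdvd

theorem findDvd_eq_some {v : α × κ} {f : VecPoly α κ β} (h : o.findDvd fs v = some f) :
    f ∈ fs ∧ f ≠ 0 ∧ TermDvd (o.lt f) v := by
  induction fs with
  | nil => simp [findDvd] at h
  | cons g fs ih =>
    rw [findDvd] at h
    split_ifs at h with hf
    · obtain rfl := Option.some.inj h
      exact ⟨List.mem_cons_self, hf⟩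
    · exact ⟨List.mem_cons_of_mem _ (ih h).1, (ih h).2⟩

/-- The leading monomials cancel, so the update of `trdAux` by tails is a genuine reduction step. -/
theorem tail_sub_monomMult_tail {p f : VecPoly α κ β} (hf : f ≠ 0)
    (h : TermDvd (o.lt f) (o.lt p)) :
    o.tail p - monomMult (o.lc p / o.lc f) (o.lp p / o.lp f) (o.tail f) =
      p - monomMult (o.lc p / o.lc f) (o.lp p / o.lp f) f := by
  rw [tail_eq_sub, tail_eq_sub, monomMult_sub, monomMult_single, lp, lp, h.stimes_div,
    div_mul_cancel₀ _ (o.lc_ne_zero hf)]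
  abel

theorem lt_of_tail_sub_apply_ne_zero {p f : VecPoly α κ β}
    (h : TermDvd (o.lt f) (o.lt p)) {v : α × κ}
    (hv : (o.tail p - monomMult (o.lc p / o.lc f) (o.lp p / o.lp f) (o.tail f)) v ≠ 0) :
    o.ordTerm.lt v (o.lt p) := by
  by_cases h0 : o.tail p v = 0
  · have : monomMult (o.lc p / o.lc f) (o.lp p / o.lp f) (o.tail f) v ≠ 0 := by
      simpa [h0] using hv
    obtain ⟨w, rfl, hw⟩ := exists_of_monomMult_apply_ne_zero this
    have := o.stimes_strictMono (o.lp p / o.lp f) (o.lt_of_tail_apply_ne_zero hw)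
    rwa [lp, lp, h.stimes_div] at this
  · exact o.lt_of_tail_apply_ne_zero h0

/-- What `trdAux` achieves on the input `p` with accumulator `r`. -/
def TrdSpec (o : TermOrder α κ) (d : α → ℕ) (n : ℕ) (fs : List (VecPoly α κ β))
    (p r r' : VecPoly α κ β) : Prop :=
  ((∀ v, r v ≠ 0 → o.IrredTerm {f | f ∈ fs} v) → ∀ v, r' v ≠ 0 → o.IrredTerm {f | f ∈ fs} v) ∧
  (∀ u, (∀ v, p v ≠ 0 → o.ordTerm.lt v u) →
    p + r - r' ∈ o.repSpan {f | f ∈ fs} fun v => d v.1 ≤ n ∧ o.ordTerm.lt v u) ∧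
  ((∀ v, r v ≠ 0 → ∀ w, p w ≠ 0 → o.ordTerm.lt w v) →
    Relation.ReflTransGen (o.Red {f | f ∈ fs}) (p + r) r') ∧
  (GradeLE d n r → GradeLE d n r')

/-- Each round lowers the leading term of `p` within grade at most `n`. The reduction chain of
`TrdSpec` requires the terms of `r` to lie above those of `p`, so that the accumulator does not
disturb the coefficient being reduced. -/
theorem trdAux_spec [WellFoundedLT κ] {d : α → ℕ} (hd : IsDicksonGrading d) {n : ℕ}
    (hfs : ∀ f ∈ fs, GradeLE d n f) (p : VecPoly α κ β) (hp : GradeLE d n p)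
    (r : VecPoly α κ β) : ∃ r', o.trdAux fs p r = some r' ∧ TrdSpec o d n fs p r r' := by
  -- One round, isolated because it is used twice: inside the induction on a strict upper bound of
  -- grade at most `n`, and once for the original `p`, for which such a bound need not exist. After
  -- one round `o.lt p` is one.
  have step : ∀ p : VecPoly α κ β, GradeLE d n p →
      (p ≠ 0 → ∀ p' : VecPoly α κ β, GradeLE d n p' → (∀ v, p' v ≠ 0 → o.ordTerm.lt v (o.lt p)) →
        ∀ r, ∃ r', o.trdAux fs p' r = some r' ∧ TrdSpec o d n fs p' r r') →
      ∀ r, ∃ r', o.trdAux fs p r = some r' ∧ TrdSpec o d n fs p r r' := by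
    clear hp p r
    intro p hp ih r
    let _ := o.ordTerm
    rw [trdAux]
    by_cases h0 : p = 0
    · subst h0
      exact ⟨r, by simp, id, fun u _ => by simp, fun _ => by rw [zero_add], id⟩
    rw [if_neg h0]
    have hlc := o.lc_ne_zero h0
    cases hf : o.findDvd fs (o.lt p) with
    | none =>
      have htail : o.tail p + (r + DFinsupp.single (o.lt p) (o.lc p)) = p + r := by
        rw [tail_eq_sub]; abel
      obtain ⟨r', hr', h1, h2, h3, h4⟩ := ih h0 (o.tail p) (hp.tail o)
        (fun v hv => o.lt_of_tail_apply_ne_zero hv) (r + DFinsupp.single (o.lt p) (o.lc p))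
      rw [htail] at h2 h3
      have hsupp : ∀ v, (r + DFinsupp.single (o.lt p) (o.lc p) : VecPoly α κ β) v ≠ 0 →
          r v ≠ 0 ∨ v = o.lt p := by
        intro v hv
        by_contra hcon
        push Not at hcon
        apply hv
        rw [DFinsupp.add_apply, hcon.1, DFinsupp.single_apply, dif_neg hcon.2.symm, add_zero]
      refine ⟨r', hr', fun h => h1 fun v hv => ?_, fun u hu => h2 u fun v hv => ?_,
        fun h => h3 fun v hv w hw => ?_,
        fun h => h4 fun v hv => ?_⟩
      · rcases hsupp v hv with hv | rfl
        · exact h v hv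
        · exact findDvd_eq_none hf
      · exact (o.lt_of_tail_apply_ne_zero hv).trans (hu _ hlc)
      · rcases hsupp v hv with hv | rfl
        · exact (o.lt_of_tail_apply_ne_zero hw).trans (h v hv _ hlc)
        · exact o.lt_of_tail_apply_ne_zero hw
      · rcases hsupp v hv with hv | rfl
        · exact h v hv
        · exact hp _ hlc
    | some f =>
      obtain ⟨hfm, hf0, hdvd⟩ := findDvd_eq_some hf
      have hst : stimes (o.lp p / o.lp f) (o.lt f) = o.lt p := hdvd.stimes_div
      have hlt : ∀ v, (o.tail p - monomMult (o.lc p / o.lc f) (o.lp p / o.lp f) (o.tail f)) v ≠ 0 →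
          o.ordTerm.lt v (o.lt p) := fun v => lt_of_tail_sub_apply_ne_zero hdvd
      have hgrade : GradeLE d n
          (o.tail p - monomMult (o.lc p / o.lc f) (o.lp p / o.lp f) (o.tail f)) := by
        refine (hp.tail o).sub (((hfs f hfm).tail o).monomMult hd ?_ _)
        refine le_trans (hd.le_of_dvd ?_) (hp _ hlc)
        exact Dvd.intro _ (congrArg Prod.fst hst)
      obtain ⟨r', hr', h1, h2, h3, h4⟩ := ih h0 _ hgrade hlt r
      rw [tail_sub_monomMult_tail hf0 hdvd] at h2 h3 hlt
      refine ⟨r', hr', h1, fun u hu => ?_, fun h => ?_, h4⟩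
      · have h2' := h2 u fun v hv => (hlt v hv).trans (hu _ hlc)
        have := add_mem h2' (monomMult_mem_repSpan (o := o) (G := {f | f ∈ fs})
          (P := fun v => d v.1 ≤ n ∧ o.ordTerm.lt v u) (o.lc p / o.lc f) (o.lp p / o.lp f)
          hfm hf0 (by rw [hst]; exact ⟨hp _ hlc, hu _ hlc⟩))
        convert this using 1
        abel
      · refine .head ?_ (h3 fun v hv w hw => (hlt w hw).trans (h v hv _ hlc))
        have hr0 : r (o.lt p) = 0 := by
          by_contra hr0
          exact lt_irrefl _ (h _ hr0 _ hlc)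
        have hc : (p + r) (o.lt p) = o.lc p := by
          rw [DFinsupp.add_apply, hr0, add_zero]; rfl
        refine ⟨f, hfm, o.lp p / o.lp f, hf0, ?_, ?_⟩
        · rwa [hst, hc]
        · rw [hst, hc]; abel
  have hwf := o.wellFoundedOn_grade_le hd n
  have main : ∀ u, d u.1 ≤ n → ∀ p : VecPoly α κ β, GradeLE d n p →
      (∀ v, p v ≠ 0 → o.ordTerm.lt v u) →
      ∀ r, ∃ r', o.trdAux fs p r = some r' ∧ TrdSpec o d n fs p r r' := by
    intro u hu
    refine hwf.induction (P := fun u => ∀ p : VecPoly α κ β, GradeLE d n p →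
      (∀ v, p v ≠ 0 → o.ordTerm.lt v u) →
      ∀ r, ∃ r', o.trdAux fs p r = some r' ∧ TrdSpec o d n fs p r r') hu ?_
    intro u _ ih p hp hpu
    exact step p hp fun h0 p' hp' hlt =>
      ih (o.lt p) (hp _ (o.lc_ne_zero h0)) (hpu _ (o.lc_ne_zero h0)) p' hp' hlt
  exact step p hp (fun h0 p' hp' hlt => main (o.lt p) (hp _ (o.lc_ne_zero h0)) p' hp' hlt) r

theorem trd_spec [WellFoundedLT κ] {d : α → ℕ} (hd : IsDicksonGrading d) {n : ℕ}
    (hfs : ∀ f ∈ fs, GradeLE d n f) {p : VecPoly α κ β} (hp : GradeLE d n p) :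
    ∃ r, o.trd fs p = some r ∧ (∀ v, r v ≠ 0 → o.IrredTerm {f | f ∈ fs} v) ∧
      (∀ u, (∀ v, p v ≠ 0 → o.ordTerm.lt v u) →
        p - r ∈ o.repSpan {f | f ∈ fs} fun v => d v.1 ≤ n ∧ o.ordTerm.lt v u) ∧
      Relation.ReflTransGen (o.Red {f | f ∈ fs}) p r ∧ GradeLE d n r := by
  obtain ⟨r, hr, h1, h2, h3, h4⟩ := trdAux_spec (o := o) hd hfs p hp 0
  simp only [add_zero] at h2 h3
  exact ⟨r, hr, h1 fun v hv => absurd rfl hv, h2, h3 fun v hv => absurd rfl hv,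
    h4 fun v hv => absurd rfl hv⟩

theorem exists_forall_gradeLE (d : α → ℕ) (fs : List (VecPoly α κ β)) :
    ∃ n₀, ∀ n, n₀ ≤ n → ∀ f ∈ fs, GradeLE d n f := by
  refine ⟨(fs.toFinset.biUnion DFinsupp.support).sup fun v => d v.1, fun n hn f hf v hv => ?_⟩
  refine le_trans (Finset.le_sup (f := fun v : α × κ => d v.1) ?_) hn
  simp only [Finset.mem_biUnion, List.mem_toFinset, DFinsupp.mem_support_iff]
  exact ⟨f, hf, hv⟩

theorem not_red_of_forall_irredTerm {p : VecPoly α κ β} (h : ∀ v, p v ≠ 0 → o.IrredTerm F v) :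
    ¬ ∃ q, o.Red F p q := by
  rintro ⟨q, f, hf, t, h0, hp, -⟩
  exact h _ hp f hf h0 (termDvd_iff_exists_stimes.2 ⟨t, rfl⟩)

theorem exists_trd_eq_some [WellFoundedLT κ] (fs : List (VecPoly α κ β)) (p : VecPoly α κ β) :
    ∃ r, o.trd fs p = some r ∧ o.IsNormalForm {f | f ∈ fs} p r ∧
      ∀ v, r v ≠ 0 → o.IrredTerm {f | f ∈ fs} v := by
  obtain ⟨d, hd⟩ := GradedDicksonPowerprod.ex_dgrad (α := α)
  obtain ⟨n, hn⟩ := exists_forall_gradeLE d (p :: fs)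
  have hn := hn n le_rfl
  obtain ⟨r, hr, h1, -, h3, -⟩ := trd_spec (o := o) hd (fun f hf => hn f (List.mem_cons_of_mem _ hf))
    (hn p List.mem_cons_self)
  exact ⟨r, hr, ⟨h3, not_red_of_forall_irredTerm h1⟩, h1⟩

theorem sub_mem_pmdl_of_red {p q : VecPoly α κ β} (h : Relation.ReflTransGen (o.Red F) p q) :
    p - q ∈ pmdlSubmodule F := by
  induction h with
  | refl => rw [sub_self]; exact zero_mem _
  | tail _ h ih =>
    obtain ⟨f, hf, t, -, -, rfl⟩ := h
    rw [← sub_add]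
    exact add_mem ih (monomMult_mem_pmdl _ t (InPmdl.base f hf))

end TotalReduction

/-! ### The leading term condition and Buchberger's criterion -/

section LeadingTermCriterion

/-- The leading term of every non-zero element of the submodule generated by `F` is divisible by
that of a non-zero element of `F`. -/
def LeadCond (F : Set (VecPoly α κ β)) : Prop :=
  ∀ p ∈ pmdl F, p ≠ 0 → ¬ o.IrredTerm F (o.lt p)

variable {o} {fs : List (VecPoly α κ β)} {F : Set (VecPoly α κ β)}

theorem LeadCond.eq_zero (h : o.LeadCond F) {p : VecPoly α κ β} (hp : p ∈ pmdl F)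
    (hirr : ∀ v, p v ≠ 0 → o.IrredTerm F v) : p = 0 := by
  by_contra h0
  exact h p hp h0 (hirr _ (o.lc_ne_zero h0))

/-- Totally reduce both ends: the normal forms differ by an element of the submodule all of whose
terms are irreducible, hence agree. -/
theorem LeadCond.isGB [WellFoundedLT κ] (h : o.LeadCond {f | f ∈ fs}) :
    o.IsGB {f | f ∈ fs} := by
  intro a b c hab hac
  obtain ⟨b', -, hb, hb'⟩ := exists_trd_eq_some (o := o) fs b
  obtain ⟨c', -, hc, hc'⟩ := exists_trd_eq_some (o := o) fs c
  have hmem : b' - c' ∈ pmdlSubmodule {f | f ∈ fs} := by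
    have := sub_mem (sub_mem_pmdl_of_red (hac.trans hc.1)) (sub_mem_pmdl_of_red (hab.trans hb.1))
    rwa [sub_sub_sub_cancel_left] at this
  have := h.eq_zero hmem fun v hv => by
    by_cases h0 : b' v = 0
    · exact hc' v (by simpa [h0] using hv)
    · exact hb' v h0
  exact ⟨b', hb.1, sub_eq_zero.1 this ▸ hc.1⟩

theorem LeadCond.mem_pmdl_iff [WellFoundedLT κ] (h : o.LeadCond {f | f ∈ fs})
    (p : VecPoly α κ β) : ∃ r, o.trd fs p = some r ∧ o.IsNormalForm {f | f ∈ fs} p r ∧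
      (p ∈ pmdl {f | f ∈ fs} ↔ r = 0) := by
  obtain ⟨r, hr, hn, hirr⟩ := exists_trd_eq_some (o := o) fs p
  have hsub := sub_mem_pmdl_of_red hn.1
  refine ⟨r, hr, hn, fun hp => h.eq_zero ?_ hirr, ?_⟩
  · have := sub_mem (mem_pmdlSubmodule.2 hp) hsub
    rwa [sub_sub_cancel] at this
  · rintro rfl
    rwa [sub_zero] at hsub

theorem lcm_div_mul_left (s t : α) :
    GradedDicksonPowerprod.lcm s t / s * s = GradedDicksonPowerprod.lcm s t := by
  rw [mul_comm]
  exact (dvd_iff_mul_div _ _).1 (GradedDicksonPowerprod.dvd_lcm s t)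

theorem lcm_div_mul_right (s t : α) :
    GradedDicksonPowerprod.lcm s t / t * t = GradedDicksonPowerprod.lcm s t := by
  rw [GradedDicksonPowerprod.lcm_comm, lcm_div_mul_left]

theorem spoly_comm (p q : VecPoly α κ β) : o.spoly p q = - o.spoly q p := by
  unfold spoly
  by_cases h : (o.lt p).2 = (o.lt q).2
  · rw [if_pos h, if_pos h.symm, neg_sub, GradedDicksonPowerprod.lcm_comm]
  · rw [if_neg h, if_neg (Ne.symm h), neg_zero]

theorem spoly_mem_pmdl {p q : VecPoly α κ β} (hp : p ∈ F) (hq : q ∈ F) : o.spoly p q ∈ pmdl F := by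
  unfold spoly
  split_ifs
  · exact sub_mem (H := pmdlSubmodule F)
      (monomMult_mem_pmdl _ _ (.base p hp)) (monomMult_mem_pmdl _ _ (.base q hq))
  · exact .zero

theorem gradeLE_spoly {d : α → ℕ} (hd : IsDicksonGrading d) {n : ℕ} {p q : VecPoly α κ β}
    (hn : d 1 ≤ n) (hp : GradeLE d n p) (hq : GradeLE d n q) :
    GradeLE d n (o.spoly p q) := by
  unfold spoly
  have hl : d (GradedDicksonPowerprod.lcm (o.lp p) (o.lp q)) ≤ n :=
    (hd.lcm_le _ _).trans (max_le (hp.lp_le o hn) (hq.lp_le o hn))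
  split_ifs
  · refine (hp.monomMult hd ?_ _).sub (hq.monomMult hd ?_ _)
    · exact (hd.le_of_dvd (Dvd.intro _ (lcm_div_mul_left _ _))).trans hl
    · exact (hd.le_of_dvd (Dvd.intro _ (lcm_div_mul_right _ _))).trans hl
  · exact fun v hv => absurd rfl hv

/-- Both scaled multiples have the lcm as leading term with coefficient `1`, so these monomials
cancel. -/
theorem lt_lcm_of_spoly_apply_ne_zero {p q : VecPoly α κ β} (hp0 : p ≠ 0) (hq0 : q ≠ 0)
    {v : α × κ} (hv : o.spoly p q v ≠ 0) :
    o.ordTerm.lt v (GradedDicksonPowerprod.lcm (o.lp p) (o.lp q), (o.lt p).2) := by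
  let _ := o.ordTerm
  unfold spoly at hv
  split_ifs at hv with h
  · have hsp : stimes (GradedDicksonPowerprod.lcm (o.lp p) (o.lp q) / o.lp p) (o.lt p) =
        (GradedDicksonPowerprod.lcm (o.lp p) (o.lp q), (o.lt p).2) :=
      Prod.ext (lcm_div_mul_left _ _) rfl
    have hsq : stimes (GradedDicksonPowerprod.lcm (o.lp p) (o.lp q) / o.lp q) (o.lt q) =
        (GradedDicksonPowerprod.lcm (o.lp p) (o.lp q), (o.lt p).2) :=
      Prod.ext (lcm_div_mul_right _ _) h.symm
    dsimp only at hv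
    refine lt_of_le_of_ne ?_ ?_
    · by_contra hcon
      apply hv
      rw [DFinsupp.sub_apply, sub_eq_zero]
      trans 0
      · by_contra h'
        exact hcon (hsp ▸ o.le_of_monomMult_apply_ne_zero h')
      · by_contra h'
        exact hcon (hsq ▸ o.le_of_monomMult_apply_ne_zero (Ne.symm h'))
    · rintro rfl
      apply hv
      rw [DFinsupp.sub_apply]
      nth_rw 1 [← hsp]
      rw [← hsq, monomMult_apply_stimes_lt, monomMult_apply_stimes_lt,
        one_div_mul_cancel (o.lc_ne_zero hp0), one_div_mul_cancel (o.lc_ne_zero hq0), sub_self]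
  · exact absurd rfl hv

/-- A common leading term of two multiples is a multiple of the lcm, so the cancellation between
them is a multiple of the S-polynomial. -/
theorem exists_monomMult_spoly_eq {p q : VecPoly α κ β} {s t : α}
    (h : stimes s (o.lt p) = stimes t (o.lt q)) :
    ∃ a, stimes a (GradedDicksonPowerprod.lcm (o.lp p) (o.lp q), (o.lt p).2) =
        stimes s (o.lt p) ∧
      monomMult 1 a (o.spoly p q) =
        monomMult (1 / o.lc p) s p - monomMult (1 / o.lc q) t q := by
  have h1 : s * o.lp p = t * o.lp q := congrArg Prod.fst h
  have h2 : (o.lt p).2 = (o.lt q).2 := (congrArg Prod.snd h :)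
  obtain ⟨a, ha⟩ : GradedDicksonPowerprod.lcm (o.lp p) (o.lp q) ∣ s * o.lp p :=
    GradedDicksonPowerprod.lcm_dvd _ _ _ (Dvd.intro_left _ rfl) (h1 ▸ Dvd.intro_left _ rfl)
  rw [mul_comm _ a] at ha
  refine ⟨a, Prod.ext ha.symm rfl, ?_⟩
  have hs : a * (GradedDicksonPowerprod.lcm (o.lp p) (o.lp q) / o.lp p) = s := by
    apply mul_right_cancel (b := o.lp p)
    rw [mul_assoc, lcm_div_mul_left, ha]
  have ht : a * (GradedDicksonPowerprod.lcm (o.lp p) (o.lp q) / o.lp q) = t := by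
    apply mul_right_cancel (b := o.lp q)
    rw [mul_assoc, lcm_div_mul_right, ← h1, ha]
  rw [spoly, if_pos h2]
  dsimp only
  rw [monomMult_sub, monomMult_monomMult, monomMult_monomMult, hs, ht, one_mul, one_mul]

/-- **Buchberger's criterion**, with representations of bounded grade. -/
theorem not_irredTerm_of_mem_repSpan [WellFoundedLT κ] {d : α → ℕ} (hd : IsDicksonGrading d)
    {n : ℕ}
    (hS : ∀ p ∈ F, ∀ q ∈ F, p ≠ 0 → q ≠ 0 → (o.lt p).2 = (o.lt q).2 →
      o.spoly p q ∈ o.repSpan F fun v => d v.1 ≤ n ∧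
        o.ordTerm.lt v (GradedDicksonPowerprod.lcm (o.lp p) (o.lp q), (o.lt p).2))
    {u : α × κ} (hu : d u.1 ≤ n) {p : VecPoly α κ β}
    (hp : p ∈ o.repSpan F fun v => d v.1 ≤ n ∧ o.ordTerm.le v u) (h0 : p ≠ 0) :
    ¬ o.IrredTerm F (o.lt p) := by
  let _ := o.ordTerm
  refine (o.wellFoundedOn_grade_le hd n).induction (P := fun u => ∀ p : VecPoly α κ β,
    (p ∈ o.repSpan F fun v => d v.1 ≤ n ∧ o.ordTerm.le v u) → p ≠ 0 →
      ¬ o.IrredTerm F (o.lt p)) hu ?_ p hp h0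
  clear hp h0 hu p u
  intro u hu ih p hp h0
  -- A representation strictly below `u` is bounded by some smaller `w`, where induction applies.
  have descend : (p ∈ o.repSpan F fun v => d v.1 ≤ n ∧ o.ordTerm.lt v u) →
      ¬ o.IrredTerm F (o.lt p) := by
    intro hp'
    rcases eq_zero_or_exists_mem_repSpan_le hp' with rfl | ⟨w, hw, hpw⟩
    · exact absurd rfl h0
    · exact ih w hw.1 hw.2 p (repSpan_mono subset_rfl (fun v hv => ⟨hv.1.1, hv.2⟩) hpw) h0
  by_cases hgen : ∃ t, ∃ g ∈ F, g ≠ 0 ∧ stimes t (o.lt g) = u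
  · obtain ⟨t, g, hg, hg0, rfl⟩ := hgen
    -- All multiples with leading term exactly `u` are proportional to the fixed `monomMult 1 t g`
    -- modulo lower ones, by the S-polynomial hypothesis. So one coefficient `c` decides: if it
    -- vanishes, descend; otherwise `u` is the leading term, visibly divisible.
    have hle : (o.repSpan F fun v => d v.1 ≤ n ∧ o.ordTerm.le v (stimes t (o.lt g))) ≤
        Submodule.span β {monomMult 1 t g} ⊔
          o.repSpan F fun v => d v.1 ≤ n ∧ o.ordTerm.lt v (stimes t (o.lt g)) := by
      refine Submodule.span_le.2 ?_
      rintro _ ⟨t', g', hg', hg0', ⟨hn, hle⟩, rfl⟩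
      rcases lt_or_eq_of_le hle with hlt | heq
      · exact Submodule.mem_sup_right (monomMult_mem_repSpan _ _ hg' hg0' ⟨hn, hlt⟩)
      · obtain ⟨a, ha, hspoly⟩ := exists_monomMult_spoly_eq heq
        have hmem : monomMult 1 a (o.spoly g' g) ∈ o.repSpan F fun v =>
            d v.1 ≤ n ∧ o.ordTerm.lt v (stimes t (o.lt g)) := by
          refine monomMult_mem_repSpan_of_mem a
            (hS g' hg' g hg hg0' hg0 (congrArg Prod.snd heq :)) fun v hv => ⟨?_, ?_⟩
          · refine (hd.1 a v.1).trans_le (max_le ?_ hv.1)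
            exact (hd.le_of_dvd (Dvd.intro _ (congrArg Prod.fst (ha.trans heq)))).trans hu
          · rw [← heq, ← ha]
            exact o.stimes_strictMono a hv.2
        have hlc := o.lc_ne_zero hg0'
        have hdecomp : monomMult 1 t' g' = (o.lc g' / o.lc g) • monomMult 1 t g +
            o.lc g' • monomMult 1 a (o.spoly g' g) := by
          rw [hspoly, monomMult_eq_smul (1 / _), monomMult_eq_smul (1 / o.lc g), smul_sub,
            smul_smul, smul_smul, mul_one_div, mul_one_div, div_self hlc, one_smul]
          abel
        rw [SetLike.mem_coe, hdecomp]
        exact Submodule.add_mem_sup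
          (Submodule.smul_mem _ _ (Submodule.mem_span_singleton_self _))
          (Submodule.smul_mem _ _ hmem)
    obtain ⟨m, hm, q, hq, rfl⟩ := Submodule.mem_sup.1 (hle hp)
    obtain ⟨c, rfl⟩ := Submodule.mem_span_singleton.1 hm
    by_cases hc : c = 0
    · exact descend (by simpa [hc] using hq)
    have hqlt : ∀ w, q w ≠ 0 → o.ordTerm.lt w (stimes t (o.lt g)) := fun w hw => by
      obtain ⟨v, hv, hwv⟩ := exists_le_of_mem_repSpan hq hw
      exact lt_of_le_of_lt hwv hv.2
    have hlt : o.lt (c • monomMult 1 t g + q) = stimes t (o.lt g) := by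
      refine o.lt_eq_of_forall_le ?_ fun w hw => ?_
      · have hq0 : q (stimes t (o.lt g)) = 0 := by
          by_contra h
          exact lt_irrefl _ (hqlt _ h)
        simp [hq0, monomMult_apply_stimes_lt, hc, o.lc_ne_zero hg0]
      · by_cases hw0 : q w = 0
        · refine o.le_of_monomMult_apply_ne_zero (c := 1) fun h => hw ?_
          simp [hw0, h]
        · exact (hqlt w hw0).le
    rw [hlt]
    exact fun h => h g hg hg0 (termDvd_iff_exists_stimes.2 ⟨t, rfl⟩)
  · refine descend (Submodule.span_mono ?_ hp)
    rintro _ ⟨t, g, hg, hg0, ⟨hn, hle⟩, rfl⟩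
    exact ⟨t, g, hg, hg0, ⟨hn, lt_of_le_of_ne hle fun h => hgen ⟨t, g, hg, hg0, h⟩⟩, rfl⟩

/-- A given element may need multiples of grade above `n`; the S-polynomial representations remain
valid for the larger bound `max n n'`. -/
theorem leadCond_of_spoly_mem [WellFoundedLT κ] {d : α → ℕ} (hd : IsDicksonGrading d) {n : ℕ}
    (hS : ∀ p ∈ F, ∀ q ∈ F, p ≠ 0 → q ≠ 0 → (o.lt p).2 = (o.lt q).2 →
      o.spoly p q ∈ o.repSpan F fun v => d v.1 ≤ n ∧
        o.ordTerm.lt v (GradedDicksonPowerprod.lcm (o.lp p) (o.lp q), (o.lt p).2)) :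
    o.LeadCond F := by
  intro p hp h0
  obtain ⟨n', hn'⟩ := exists_forall_mem_repSpan_grade_le d (mem_repSpan_of_mem_pmdl (o := o) hp)
  rcases eq_zero_or_exists_mem_repSpan_le (hn' (max n n') (le_max_right _ _)) with
    rfl | ⟨u, hu, hpu⟩
  · exact absurd rfl h0
  · exact not_irredTerm_of_mem_repSpan hd (fun f hf g hg hf0 hg0 h => repSpan_mono subset_rfl
      (fun v hv => ⟨hv.1.trans (le_max_left _ _), hv.2⟩) (hS f hf g hg hf0 hg0 h)) hu hpu h0

end LeadingTermCriterion

end TermOrder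

/-! ### Bookkeeping of pairs -/

section Pairs

variable {γ : Type*}

theorem mem_of_mem_listPairs {l : List γ} {x : γ × γ} (hx : x ∈ listPairs l) :
    x.1 ∈ l ∧ x.2 ∈ l := by
  induction l with
  | nil => simp [listPairs] at hx
  | cons a l ih =>
    rw [listPairs, List.mem_append] at hx
    rcases hx with hx | hx
    · obtain ⟨b, hb, rfl⟩ := List.mem_map.1 hx
      exact ⟨List.mem_cons_self, List.mem_cons_of_mem _ hb⟩
    · exact ⟨List.mem_cons_of_mem _ (ih hx).1, List.mem_cons_of_mem _ (ih hx).2⟩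

theorem mem_listPairs_or {l : List γ} {p q : γ} (hp : p ∈ l) (hq : q ∈ l) (h : p ≠ q) :
    (p, q) ∈ listPairs l ∨ (q, p) ∈ listPairs l := by
  induction l with
  | nil => simp at hp
  | cons a l ih =>
    simp only [listPairs, List.mem_append, List.mem_map, Prod.mk.injEq]
    rcases List.mem_cons.1 hp with rfl | hp' <;> rcases List.mem_cons.1 hq with rfl | hq'
    · exact absurd rfl h
    · exact .inl (.inl ⟨q, hq', rfl, rfl⟩)
    · exact .inr (.inl ⟨p, hp', rfl, rfl⟩)
    · exact (ih hp' hq').imp .inr .inr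

variable [DecidableEq γ]

theorem mem_diffList_singleton {l : List γ} {x y : γ} : y ∈ diffList l [x] ↔ y ∈ l ∧ y ≠ x := by
  simp [diffList]

theorem length_diffList_lt {l : List γ} {x : γ} (hx : x ∈ l) :
    (diffList l [x]).length < l.length := by
  rw [diffList, List.length_filter_lt_length_iff_exists]
  exact ⟨x, hx, by simp⟩

theorem addPairs_nil_nil (l : List γ) : addPairs [] [] l = listPairs l.dedup := by
  simp [addPairs, List.product]

theorem addPairs_nil_right (bs : List γ) (ps : List (γ × γ)) : addPairs bs ps [] = ps := by
  simp [addPairs, listPairs, List.product]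

theorem mem_addPairs_singleton {bs : List γ} {ps : List (γ × γ)} {h : γ} {x : γ × γ} :
    x ∈ addPairs bs ps [h] ↔ x ∈ ps ∨ x.1 = h ∧ x.2 ∈ bs := by
  simp [addPairs, listPairs, List.product, Prod.ext_iff, and_comm, eq_comm]

end Pairs

/-! ### Correctness and termination of Buchberger's algorithm -/

namespace TermOrder

variable {α κ β : Type*} [GradedDicksonPowerprod α] [DecidableEq α] [LinearOrder κ] [OrderBot κ]
  [Field β] [DecidableEq β] (o : TermOrder α κ)

/-- `1 e_i` divides every term of component `i`, so the early exit needs no S-polynomials. -/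
theorem leadCond_of_genWholeModule {o : TermOrder α κ} {bs : List (VecPoly α κ β)}
    (h : o.genWholeModule bs = true) : o.LeadCond {b | b ∈ bs} := by
  intro p hp h0 hirr
  obtain ⟨a, ha, w, hw, hcomp⟩ := exists_component_of_mem_pmdl hp (o.lc_ne_zero h0)
  rw [genWholeModule, List.all_eq_true] at h
  obtain ⟨b, hb, hb0, hlt⟩ := of_decide_eq_true (h a ha) w (DFinsupp.mem_support_iff.2 hw)
  refine hirr b hb hb0 ?_
  rw [hlt]
  exact ⟨hcomp, one_dvd _⟩

/-- The S-polynomial of `p` and `q` has a representation of grade at most `n` in terms of `F` whose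
terms are smaller than the least common multiple of the leading terms. -/
def SpolyRep (d : α → ℕ) (n : ℕ) (F : Set (VecPoly α κ β)) (p q : VecPoly α κ β) : Prop :=
  o.spoly p q ∈ o.repSpan F fun v => d v.1 ≤ n ∧
    o.ordTerm.lt v (GradedDicksonPowerprod.lcm (o.lp p) (o.lp q), (o.lt p).2)

/-- The invariant of Buchberger's algorithm on the input `fs`, with grades bounded by `n`. -/
structure GBInv (d : α → ℕ) (n : ℕ) (fs bs : List (VecPoly α κ β))
    (ps : List (VecPoly α κ β × VecPoly α κ β)) : Prop where
  subset : ∀ f ∈ fs, f ∈ bs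
  mem_pmdl : ∀ b ∈ bs, b ∈ pmdl {f | f ∈ fs}
  gradeLE : ∀ b ∈ bs, GradeLE d n b
  mem_of_mem : ∀ x ∈ ps, x.1 ∈ bs ∧ x.2 ∈ bs
  processed : ∀ p ∈ bs, ∀ q ∈ bs, p ≠ q → p ≠ 0 → q ≠ 0 → (o.lt p).2 = (o.lt q).2 →
    (p, q) ∈ ps ∨ (q, p) ∈ ps ∨ o.SpolyRep d n {b | b ∈ bs} p q

variable {o} {d : α → ℕ} {n : ℕ} {fs bs : List (VecPoly α κ β)}
  {ps : List (VecPoly α κ β × VecPoly α κ β)}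

theorem SpolyRep.symm {F : Set (VecPoly α κ β)} {p q : VecPoly α κ β}
    (hlt : (o.lt p).2 = (o.lt q).2) (h : o.SpolyRep d n F p q) : o.SpolyRep d n F q p := by
  unfold SpolyRep
  rw [spoly_comm, GradedDicksonPowerprod.lcm_comm, ← hlt]
  exact neg_mem h

theorem SpolyRep.mono {F G : Set (VecPoly α κ β)} {p q : VecPoly α κ β}
    (hFG : F ⊆ G) (h : o.SpolyRep d n F p q) : o.SpolyRep d n G p q :=
  repSpan_mono hFG (fun _ => id) h

theorem GBInv.leadCond [WellFoundedLT κ] (hd : IsDicksonGrading d) (h : o.GBInv d n fs bs []) :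
    o.LeadCond {b | b ∈ bs} := by
  refine leadCond_of_spoly_mem hd (n := n) fun p hp q hq hp0 hq0 hlt => ?_
  by_cases hpq : p = q
  · subst hpq
    simp [spoly]
  · have := h.processed p hp q hq hpq hp0 hq0 hlt
    simp only [List.not_mem_nil, false_or] at this
    exact this

theorem GBInv.init (hfs : ∀ f ∈ fs, GradeLE d n f) : o.GBInv d n fs fs (addPairs [] [] fs) where
  subset _ := id
  mem_pmdl f hf := InPmdl.base f hf
  gradeLE := hfs
  mem_of_mem x hx := by
    rw [addPairs_nil_nil] at hx
    exact (mem_of_mem_listPairs hx).imp List.mem_dedup.1 List.mem_dedup.1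
  processed p hp q hq hpq _ _ _ := by
    rw [addPairs_nil_nil, ← or_assoc]
    exact .inl (mem_listPairs_or (List.mem_dedup.2 hp) (List.mem_dedup.2 hq) hpq)

/-- One iteration of Buchberger's algorithm. -/
theorem GBInv.step [WellFoundedLT κ] (hd : IsDicksonGrading d) (hn : d 1 ≤ n)
    (h : o.GBInv d n fs bs ps) {p q : VecPoly α κ β} (hpq : (p, q) ∈ ps) :
    ∃ r, o.trd bs (o.spoly p q) = some r ∧ (r = 0 → o.GBInv d n fs bs (diffList ps [(p, q)])) ∧
      (r ≠ 0 → o.GBInv d n fs (bs ++ [r]) (addPairs bs (diffList ps [(p, q)]) [r]) ∧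
        d (o.lt r).1 ≤ n ∧ r ∈ pmdl {f | f ∈ fs} ∧ o.IrredTerm {b | b ∈ bs} (o.lt r)) := by
  obtain ⟨hp, hq⟩ := h.mem_of_mem _ hpq
  obtain ⟨r, hr, hirr, hrep, hred, hgrade⟩ := trd_spec (o := o) hd h.gradeLE
    (gradeLE_spoly (o := o) hd hn (h.gradeLE p hp) (h.gradeLE q hq))
  have hrmem : r ∈ pmdl {f | f ∈ fs} := by
    have hsub : pmdl {b | b ∈ bs} ⊆ pmdl {f | f ∈ fs} := pmdl_subset_of_subset_pmdl h.mem_pmdl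
    have h1 := sub_mem (H := pmdlSubmodule {b | b ∈ bs})
      (spoly_mem_pmdl (o := o) (F := {b | b ∈ bs}) hp hq) (sub_mem_pmdl_of_red hred)
    rw [sub_sub_cancel] at h1
    exact hsub h1
  -- Write the S-polynomial as (S-polynomial − `r`) + `r`; the first part is represented over `bs`,
  -- and `r` over `G` by itself. The set `G` stands for the old basis if `r = 0`, for the extended
  -- one otherwise.
  have hnew : p ≠ 0 → q ≠ 0 → ∀ G : Set (VecPoly α κ β), {b | b ∈ bs} ⊆ G → (r ≠ 0 → r ∈ G) →
      o.SpolyRep d n G p q := by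
    intro hp0 hq0 G hG hrG
    have hlt : ∀ v, o.spoly p q v ≠ 0 → _ := fun v hv => lt_lcm_of_spoly_apply_ne_zero hp0 hq0 hv
    have h1 := hrep _ hlt
    unfold SpolyRep
    rw [← sub_add_cancel (o.spoly p q) r]
    refine add_mem (repSpan_mono hG (fun _ => id) h1) ?_
    by_cases hr0 : r = 0
    · rw [hr0]; exact zero_mem _
    rw [← one_smul β r, ← monomMult_one_right]
    refine monomMult_mem_repSpan _ _ (hrG hr0) hr0 ?_
    rw [one_stimes]
    refine ⟨hgrade _ (o.lc_ne_zero hr0), ?_⟩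
    -- The leading term of `r` occurs in the S-polynomial or in its difference with `r`; both lie
    -- below the lcm.
    by_cases hs : o.spoly p q (o.lt r) = 0
    · obtain ⟨v, hv, hle⟩ := exists_le_of_mem_repSpan h1 (w := o.lt r)
        (by rw [DFinsupp.sub_apply, hs, zero_sub]; exact neg_ne_zero.2 (o.lc_ne_zero hr0))
      let _ := o.ordTerm
      exact lt_of_le_of_lt hle hv.2
    · exact hlt _ hs
  have hdiff : ∀ G : Set (VecPoly α κ β), {b | b ∈ bs} ⊆ G → (r ≠ 0 → r ∈ G) →
      ∀ a ∈ bs, ∀ b ∈ bs, a ≠ b → a ≠ 0 → b ≠ 0 → (o.lt a).2 = (o.lt b).2 →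
      (a, b) ∈ diffList ps [(p, q)] ∨ (b, a) ∈ diffList ps [(p, q)] ∨ o.SpolyRep d n G a b := by
    intro G hG hrG a ha b hb hab ha0 hb0 hlt
    simp only [mem_diffList_singleton]
    by_cases h1 : (a, b) = (p, q)
    · obtain ⟨rfl, rfl⟩ := Prod.mk.inj h1
      exact .inr (.inr (hnew ha0 hb0 G hG hrG))
    by_cases h2 : (b, a) = (p, q)
    · obtain ⟨rfl, rfl⟩ := Prod.mk.inj h2
      exact .inr (.inr ((hnew hb0 ha0 G hG hrG).symm hlt.symm))
    exact (h.processed a ha b hb hab ha0 hb0 hlt).imp (⟨·, h1⟩) (Or.imp (⟨·, h2⟩) (.mono hG))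
  refine ⟨r, hr, fun hr0 => ?_, fun hr0 => ⟨?_, hgrade _ (o.lc_ne_zero hr0), hrmem,
    hirr _ (o.lc_ne_zero hr0)⟩⟩
  · exact ⟨h.subset, h.mem_pmdl, h.gradeLE,
      fun x hx => h.mem_of_mem x (mem_diffList_singleton.1 hx).1,
      hdiff _ subset_rfl fun h => absurd hr0 h⟩
  · have hsub : {b | b ∈ bs} ⊆ {b | b ∈ bs ++ [r]} := fun b hb => List.mem_append_left _ hb
    have hrm : r ∈ bs ++ [r] := List.mem_append_right _ (List.mem_singleton_self r)
    have hcases : ∀ b ∈ bs ++ [r], b ∈ bs ∨ b = r := fun b hb => by simpa using hb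
    refine ⟨fun f hf => hsub (h.subset f hf), fun b hb => ?_, fun b hb => ?_, fun x hx => ?_,
      fun a ha b hb hab ha0 hb0 hlt => ?_⟩
    · rcases hcases b hb with hb | rfl
      · exact h.mem_pmdl b hb
      · exact hrmem
    · rcases hcases b hb with hb | rfl
      · exact h.gradeLE b hb
      · exact hgrade
    · rcases mem_addPairs_singleton.1 hx with hx | ⟨hx1, hx2⟩
      · exact (h.mem_of_mem x (mem_diffList_singleton.1 hx).1).imp (hsub ·) (hsub ·)
      · exact ⟨hx1 ▸ hrm, hsub hx2⟩
    · simp only [mem_addPairs_singleton]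
      rcases hcases a ha with ha' | rfl <;> rcases hcases b hb with hb' | rfl
      · exact (hdiff _ hsub (fun _ => hrm) a ha' b hb' hab ha0 hb0 hlt).imp .inl (.imp .inl id)
      · exact .inr (.inl (.inr ⟨rfl, ha'⟩))
      · exact .inl (.inr ⟨rfl, hb'⟩)
      · exact absurd rfl hab

/-- `bs'` extends `bs` by a non-zero polynomial whose leading term, of grade at most `n` and with
component in `C`, is not divisible by the leading terms of `bs`. -/
def Extends (o : TermOrder α κ) (d : α → ℕ) (n : ℕ) (C : Set κ) (bs' bs : List (VecPoly α κ β)) :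
    Prop :=
  ∃ r, bs' = bs ++ [r] ∧ r ≠ 0 ∧ d (o.lt r).1 ≤ n ∧ (o.lt r).2 ∈ C ∧
    o.IrredTerm {b | b ∈ bs} (o.lt r)

/-- In an infinite chain some new leading term would divide a later one, although the earlier
polynomial already belongs to the list modulo which the later one is irreducible. -/
theorem wellFounded_extends (hd : IsDicksonGrading d) (n : ℕ) {C : Set κ} (hC : C.Finite) :
    WellFounded (Extends o d n C : List (VecPoly α κ β) → List (VecPoly α κ β) → Prop) := by
  refine wellFounded_iff_isEmpty_descending_chain.2 ⟨fun ⟨f, hf⟩ => ?_⟩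
  choose r hr h0 hgrade hcomp hirr using hf
  have hmono : ∀ i j, i ≤ j → ∀ b ∈ f i, b ∈ f j := by
    intro i j hij
    induction hij with
    | refl => exact fun _ => id
    | step _ ih =>
      intro b hb
      rw [hr]
      exact List.mem_append_left _ (ih b hb)
  obtain ⟨i, j, hij, hdvd⟩ := exists_termDvd_of_grade_le hd n hC (fun k => o.lt (r k))
    fun k => ⟨hgrade k, hcomp k⟩
  refine hirr j (r i) (hmono (i + 1) j hij _ ?_) (h0 i) hdvd
  rw [hr]
  exact List.mem_append_right _ (List.mem_singleton_self _)

theorem finite_components (fs : List (VecPoly α κ β)) :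
    {i : κ | ∃ f ∈ fs, ∃ w : α × κ, f w ≠ 0 ∧ w.2 = i}.Finite := by
  refine ((fs.toFinset.biUnion DFinsupp.support).image Prod.snd).finite_toSet.subset ?_
  rintro _ ⟨f, hf, w, hw, rfl⟩
  simp only [Finset.coe_image]
  exact ⟨w, by simpa using ⟨f, hf, hw⟩, rfl⟩

variable {sel : List (VecPoly α κ β) → List (VecPoly α κ β × VecPoly α κ β) →
  List (VecPoly α κ β × VecPoly α κ β)}

/-- Lexicographic induction: each iteration either extends the basis in the sense of `Extends`, or
keeps it and shortens the list of pairs. -/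
theorem gbSchemaAux_spec [WellFoundedLT κ] (hsel : SelectsSinglePair sel)
    (hd : IsDicksonGrading d) (hn : d 1 ≤ n) (h : o.GBInv d n fs bs ps) :
    ∃ G, o.gbSchemaAux sel o.gbRed bs ps = some G ∧ o.LeadCond {g | g ∈ G} ∧
      (∀ f ∈ fs, f ∈ G) ∧ ∀ g ∈ G, g ∈ pmdl {f | f ∈ fs} := by
  induction bs using (wellFounded_extends (o := o) (β := β) hd n (finite_components fs)).induction
    generalizing ps with
  | _ bs ihbs =>
  induction hlen : ps.length using Nat.strong_induction_on generalizing ps with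
  | _ N ihps =>
  rw [gbSchemaAux]
  by_cases hdone : ps = [] ∨ o.genWholeModule bs = true
  · rw [if_pos hdone]
    refine ⟨bs, rfl, ?_, h.subset, h.mem_pmdl⟩
    rcases hdone with rfl | hdone
    · exact h.leadCond hd
    · exact leadCond_of_genWholeModule hdone
  · rw [if_neg hdone]
    push Not at hdone
    obtain ⟨⟨p, q⟩, hpq, hs⟩ := hsel bs ps hdone.1
    obtain ⟨r, hr, hzero, hne⟩ := h.step hd hn hpq
    rw [hs]
    by_cases hr0 : r = 0
    · have := ihps _ (hlen ▸ length_diffList_lt hpq) (hzero hr0) rfl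
      simpa [gbRed, hr, hr0, addPairs_nil_right] using this
    · obtain ⟨hinv, hgrade, hmem, hirr⟩ := hne hr0
      have := ihbs (bs ++ [r])
        ⟨r, rfl, hr0, hgrade, exists_component_of_mem_pmdl hmem (o.lc_ne_zero hr0), hirr⟩ hinv
      simpa [gbRed, hr, hr0] using this

/-- Buchberger's algorithm terminates, and its result generates the same submodule as the input and
satisfies the leading term criterion. -/
theorem gb_spec [WellFoundedLT κ] (o : TermOrder α κ) (hsel : SelectsSinglePair sel)
    (fs : List (VecPoly α κ β)) :
    ∃ G, o.gb sel fs = some G ∧ o.LeadCond {g | g ∈ G} ∧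
      pmdl {g | g ∈ G} = pmdl {f | f ∈ fs} := by
  obtain ⟨d, hd⟩ := GradedDicksonPowerprod.ex_dgrad (α := α)
  obtain ⟨n, hn⟩ := exists_forall_gradeLE d fs
  obtain ⟨G, hG, hlead, hsub, hmem⟩ := gbSchemaAux_spec (o := o) hsel hd (le_max_left (d 1) n)
    (GBInv.init (hn _ (le_max_right _ _)))
  exact ⟨G, hG, hlead, (pmdl_subset_of_subset_pmdl hmem).antisymm
    (pmdl_subset_of_subset_pmdl fun f hf => .base f (hsub f hf))⟩

end TermOrder

end GroebnerBases

theorem mainTheorem7 {α κ β : Type*} [GradedDicksonPowerprod α] [DecidableEq α]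
    [LinearOrder κ] [OrderBot κ] [WellFoundedLT κ] [Field β] [DecidableEq β]
    (o : GroebnerBases.TermOrder α κ)
    (sel : List (GroebnerBases.VecPoly α κ β) →
      List (GroebnerBases.VecPoly α κ β × GroebnerBases.VecPoly α κ β) →
      List (GroebnerBases.VecPoly α κ β × GroebnerBases.VecPoly α κ β))
    (hsel : GroebnerBases.SelectsSinglePair sel)
    (fs : List (GroebnerBases.VecPoly α κ β)) :
    -- `gb` terminates on `fs`; its result `G` is a Gröbner basis of the submodule generated by `fs`
    (∃ G : List (GroebnerBases.VecPoly α κ β), o.gb sel fs = some G ∧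
      o.IsGB {g | g ∈ G} ∧
      GroebnerBases.pmdl {g | g ∈ G} = GroebnerBases.pmdl {f | f ∈ fs} ∧
      -- `trd` terminates on `G` and `p` with a normal form `r` of `p` modulo `G`
      ∀ p : GroebnerBases.VecPoly α κ β, ∃ r : GroebnerBases.VecPoly α κ β,
        o.trd G p = some r ∧ o.IsNormalForm {g | g ∈ G} p r ∧
        (p ∈ GroebnerBases.pmdl {f | f ∈ fs} ↔ r = 0)) ∧
    -- hence membership is decided by the (always terminating) membership test
    ∀ p : GroebnerBases.VecPoly α κ β, ∃ b : Bool,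
      o.memTest sel fs p = some b ∧ (b = true ↔ p ∈ GroebnerBases.pmdl {f | f ∈ fs}) := by
  obtain ⟨G, hG, hlead, hpmdl⟩ := o.gb_spec hsel fs
  have hnf := hlead.mem_pmdl_iff
  rw [hpmdl] at hnf
  refine ⟨⟨G, hG, hlead.isGB, hpmdl, hnf⟩, fun p => ?_⟩
  obtain ⟨r, hr, -, hmem⟩ := hnf p
  exact ⟨decide (r = 0), by simp [GroebnerBases.TermOrder.memTest, hG, hr], by simp [hmem]⟩
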